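/- For positive real numbers $a,b$ and real $r\neq 1$ let $$C_r(a,b)=\Big(\frac{b^r+a^r}{b+a}\Big)^{\frac1{r-1}},\qquad\text{and let}\qquad C_1(a,b)=\lim_{r\to1}C_r(a,b)=\big(b^b a^a\big)^{\frac1{b+a}} .$$ Let $0<r<\infty$ and $b>a>0$. Then $$C_r(a,b)+C_{-r}(a,b)<\sqrt{\frac{3a^2+2ab+3b^2}{2}}$$ and $$C_r(a,b)^2+C_{-r}(a,b)^2>\frac{(a+b)^2}{2}.$$ -/

import Mathlib

noncomputable section

/-- The generalized inverse harmonic mean `C_r(a, b) = ((b^r + a^r) / (b + a)) ^ (1 / (r - 1))` of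
two positive numbers, for real `r`. At the removable singularity `r = 1` it takes the limiting
value `C_1(a, b) = (b^b a^a) ^ (1 / (b + a))`. -/
def genInvHarmonicMean (r a b : ℝ) : ℝ :=
  if r = 1 then (b ^ b * a ^ a) ^ (1 / (b + a))
  else ((b ^ r + a ^ r) / (b + a)) ^ (1 / (r - 1))

end

/-!
Write `a = exp (g - t)`, `b = exp (g + t)` and `L = log ∘ cosh`. Let `x ↦ l + S x` be the affine
function through the points `(1, L t)` and `(r ^ 2, L (r t))`, that is, a chord of `x ↦ L (√x t)`,
or its tangent when `r = 1`. Then `C_r = exp (g + S + r S)` and `C_{-r} = exp (g + S - r S)`, so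
that with `z = r S` the two claims become `exp (-2 l) cosh z ^ 2 < 1 + tanh t ^ 2 / 2` and
`exp (2 l) < cosh (2 z)`. On `t > 0` the quotient `L (L + 1) / t ^ 2` increases and
`L (L + 3) / t ^ 2` decreases, which says exactly that `l (l + 1) < z ^ 2 < l (l + 3)`. The lower
bound and `x ^ 2 < L x (L x + 2)` at `x = 2 z` give the second claim. The upper bound gives the
first one when `l` is small, and for the other `l` it follows from `S + z ≤ t`, which holds because
`L` is `1`-Lipschitz.
-/

open Real Set

theorem lt_of_hasDerivAt_pos {f f' : ℝ → ℝ} {a x : ℝ} (hf : ∀ y, a ≤ y → HasDerivAt f (f' y) y)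
    (hf' : ∀ y, a < y → 0 < f' y) (hx : a < x) : f a < f x := by
  refine strictMonoOn_of_hasDerivWithinAt_pos (convex_Ici a) (f' := f')
    (fun y hy => (hf y hy).continuousAt.continuousWithinAt) ?_ ?_ self_mem_Ici hx.le hx
  all_goals rw [interior_Ici]
  exacts [fun y hy => (hf y (le_of_lt hy)).hasDerivWithinAt, hf']

theorem sub_mul_sub_pos_of_strictMonoOn {f : ℝ → ℝ} {s : Set ℝ} {x y : ℝ} (hf : StrictMonoOn f s)
    (hx : x ∈ s) (hy : y ∈ s) (hxy : x ≠ y) : 0 < (y - x) * (f y - f x) := by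
  rcases hxy.lt_or_gt with h | h
  · exact mul_pos (sub_pos.2 h) (sub_pos.2 (hf hx hy h))
  · exact mul_pos_of_neg_of_neg (sub_neg.2 h) (sub_neg.2 (hf hy hx h))

section Tanh

variable {t : ℝ}

theorem cosh_sq_mul_one_sub_tanh_sq (t : ℝ) : cosh t ^ 2 * (1 - tanh t ^ 2) = 1 := by
  have hc : cosh t ≠ 0 := (cosh_pos t).ne'
  rw [tanh_eq_sinh_div_cosh]
  field_simp
  exact cosh_sq_sub_sinh_sq t

theorem one_sub_tanh_sq_pos (t : ℝ) : 0 < 1 - tanh t ^ 2 :=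
  sub_pos.2 (tanh_sq_lt_one t)

theorem tanh_pos (ht : 0 < t) : 0 < tanh t := by
  rw [tanh_eq_sinh_div_cosh]
  exact div_pos (sinh_pos_iff.2 ht) (cosh_pos t)

theorem hasDerivAt_tanh (t : ℝ) : HasDerivAt tanh (1 - tanh t ^ 2) t := by
  have hc : cosh t ≠ 0 := (cosh_pos t).ne'
  have h := (hasDerivAt_sinh t).div (hasDerivAt_cosh t) hc
  rw [show tanh = sinh / cosh from funext tanh_eq_sinh_div_cosh]
  refine h.congr_deriv ?_
  simp only [Pi.div_apply]
  field_simp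

theorem tanh_lt_self (ht : 0 < t) : tanh t < t := by
  have h := lt_of_hasDerivAt_pos (fun y _ => (hasDerivAt_id y).sub (hasDerivAt_tanh y))
    (fun y hy => by linarith [pow_pos (tanh_pos hy) 2]) ht
  simpa using h

theorem tanh_sub_mul_one_sub_tanh_sq_lt_mul (ht : 0 < t) :
    tanh t - t * (1 - tanh t ^ 2) < t * tanh t ^ 2 := by
  linarith [tanh_lt_self ht]

theorem tanh_sub_mul_one_sub_tanh_sq_lt_sq (ht : 0 < t) :
    tanh t - t * (1 - tanh t ^ 2) < tanh t ^ 2 := by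
  have h : 0 < (1 - tanh t) * (t - tanh t + t * tanh t) :=
    mul_pos (sub_pos.2 (tanh_lt_one t))
      (add_pos (sub_pos.2 (tanh_lt_self ht)) (mul_pos ht (tanh_pos ht)))
  linarith

end Tanh

/-- The logarithm of the hyperbolic cosine. -/
noncomputable def logCosh (t : ℝ) : ℝ := log (cosh t)

section LogCosh

variable {c t : ℝ}

theorem exp_logCosh (t : ℝ) : exp (logCosh t) = cosh t := exp_log (cosh_pos t)

@[simp]
theorem logCosh_zero : logCosh 0 = 0 := by simp [logCosh]

@[simp]
theorem logCosh_neg (t : ℝ) : logCosh (-t) = logCosh t := by simp [logCosh]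

theorem logCosh_pos (ht : 0 < t) : 0 < logCosh t := log_pos (one_lt_cosh.2 ht.ne')

theorem exp_sub_logCosh (t : ℝ) : exp (t - logCosh t) = 1 + tanh t := by
  have hc : cosh t ≠ 0 := (cosh_pos t).ne'
  rw [exp_sub, exp_logCosh, ← cosh_add_sinh, tanh_eq_sinh_div_cosh]
  field_simp

theorem hasDerivAt_logCosh (t : ℝ) : HasDerivAt logCosh (tanh t) t := by
  rw [tanh_eq_sinh_div_cosh]
  exact (hasDerivAt_cosh t).log (cosh_pos t).ne'

theorem abs_logCosh_sub_le (x y : ℝ) : |logCosh x - logCosh y| ≤ |x - y| := by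
  have h : LipschitzWith 1 logCosh :=
    lipschitzWith_of_nnnorm_deriv_le (fun t => (hasDerivAt_logCosh t).differentiableAt) fun t => by
      rw [(hasDerivAt_logCosh t).deriv]
      exact_mod_cast (abs_tanh_lt_one t).le
  simpa [dist_eq] using h.dist_le_mul x y

theorem logCosh_le_half_sq (t : ℝ) : logCosh t ≤ t ^ 2 / 2 := by
  rw [← exp_le_exp, exp_logCosh]
  exact cosh_le_exp_half_sq t

theorem logCosh_le_sub_half (ht : 1 ≤ t) : logCosh t ≤ t - 1 / 2 := by
  have h_one := logCosh_le_half_sq 1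
  have h_lip := le_of_abs_le (abs_logCosh_sub_le t 1)
  rw [abs_of_nonneg (sub_nonneg.2 ht)] at h_lip
  linarith

theorem lt_tanh_mul_one_add_logCosh (ht : 0 < t) : t < tanh t * (1 + logCosh t) := by
  have h := lt_of_hasDerivAt_pos (fun y _ => ((hasDerivAt_tanh y).mul
    ((hasDerivAt_logCosh y).const_add 1)).sub (hasDerivAt_id y))
    (fun y hy => by linarith [mul_pos (one_sub_tanh_sq_pos y) (logCosh_pos hy)]) ht
  simpa using h

theorem sq_lt_logCosh_mul_add_two (ht : 0 < t) : t ^ 2 < logCosh t * (logCosh t + 2) := by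
  have h := lt_of_hasDerivAt_pos (fun y _ => ((hasDerivAt_logCosh y).mul
    ((hasDerivAt_logCosh y).add_const 2)).sub (hasDerivAt_pow 2 y))
    (fun y hy => by
      simp only [Nat.cast_ofNat, Nat.add_one_sub_one, pow_one]
      linarith [lt_tanh_mul_one_add_logCosh hy]) ht
  simpa using h

theorem hasDerivAt_mul_tanh_mul_sub (c t : ℝ) :
    HasDerivAt (fun t => t * tanh t * (2 * logCosh t + c) - 2 * (logCosh t * (logCosh t + c)))
      (2 * t * tanh t ^ 2 - (2 * logCosh t + c) * (tanh t - t * (1 - tanh t ^ 2))) t := by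
  have hL := hasDerivAt_logCosh t
  refine ((((hasDerivAt_id t).mul (hasDerivAt_tanh t)).mul ((hL.const_mul 2).add_const c)).sub
    ((hL.mul (hL.add_const c)).const_mul 2)).congr_deriv ?_
  simp only [id_eq, Pi.mul_apply]
  ring

theorem two_mul_logCosh_add_one_mul_tanh_sub_lt (ht : 0 < t) :
    (2 * logCosh t + 1) * (tanh t - t * (1 - tanh t ^ 2)) < 2 * t * tanh t ^ 2 := by
  have hL : 0 < 2 * logCosh t + 1 := by linarith [logCosh_pos ht]
  -- Both cases rest on `2 * logCosh t + 1 ≤ 2 * max 1 t`.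
  rcases le_total t 1 with h | h
  · calc (2 * logCosh t + 1) * (tanh t - t * (1 - tanh t ^ 2))
        < (2 * logCosh t + 1) * (t * tanh t ^ 2) := by
          gcongr
          exact tanh_sub_mul_one_sub_tanh_sq_lt_mul ht
      _ ≤ 2 * (t * tanh t ^ 2) := by
          gcongr
          nlinarith [logCosh_le_half_sq t]
      _ = 2 * t * tanh t ^ 2 := by ring
  · calc (2 * logCosh t + 1) * (tanh t - t * (1 - tanh t ^ 2))
        < (2 * logCosh t + 1) * tanh t ^ 2 := by
          gcongr
          exact tanh_sub_mul_one_sub_tanh_sq_lt_sq ht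
      _ ≤ 2 * t * tanh t ^ 2 := by
          gcongr
          linarith [logCosh_le_sub_half h]

theorem lt_two_mul_logCosh_add_three_mul_tanh_sub (ht : 0 < t) :
    2 * t * tanh t ^ 2 < (2 * logCosh t + 3) * (tanh t - t * (1 - tanh t ^ 2)) := by
  have hderiv (y : ℝ) : HasDerivAt
      (fun t => (2 * logCosh t + 3) * (tanh t - t * (1 - tanh t ^ 2)) - 2 * t * tanh t ^ 2)
      (4 * y * tanh y * logCosh y * (1 - tanh y ^ 2)) y := by
    have hT := hasDerivAt_tanh y
    refine (((((hasDerivAt_logCosh y).const_mul 2).add_const 3).mul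
      (hT.sub ((hasDerivAt_id y).mul ((hT.pow 2).const_sub 1)))).sub
      (((hasDerivAt_id y).const_mul 2).mul (hT.pow 2))).congr_deriv ?_
    simp only [id_eq, Pi.mul_apply, Pi.sub_apply, Pi.pow_apply]
    ring
  have h := lt_of_hasDerivAt_pos (fun y _ => hderiv y) (fun y hy => by
    have := tanh_pos hy
    have := logCosh_pos hy
    have := one_sub_tanh_sq_pos y
    positivity) ht
  simpa using h

theorem two_mul_logCosh_mul_add_one_lt_mul_tanh (ht : 0 < t) :
    2 * (logCosh t * (logCosh t + 1)) < t * tanh t * (2 * logCosh t + 1) := by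
  have h := lt_of_hasDerivAt_pos (fun y _ => hasDerivAt_mul_tanh_mul_sub 1 y)
    (fun y hy => sub_pos.2 (two_mul_logCosh_add_one_mul_tanh_sub_lt hy)) ht
  simpa using h

theorem mul_tanh_lt_two_mul_logCosh_mul_add_three (ht : 0 < t) :
    t * tanh t * (2 * logCosh t + 3) < 2 * (logCosh t * (logCosh t + 3)) := by
  have h := lt_of_hasDerivAt_pos (fun y _ => (hasDerivAt_mul_tanh_mul_sub 3 y).neg)
    (fun y hy => neg_pos.2 (sub_neg.2 (lt_two_mul_logCosh_add_three_mul_tanh_sub hy))) ht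
  simpa using h

theorem hasDerivAt_logCosh_mul_add_div_sq (c : ℝ) (ht : t ≠ 0) :
    HasDerivAt (fun t => logCosh t * (logCosh t + c) / t ^ 2)
      ((t * tanh t * (2 * logCosh t + c) - 2 * (logCosh t * (logCosh t + c))) / t ^ 3) t := by
  have hL := hasDerivAt_logCosh t
  refine ((hL.mul (hL.add_const c)).div (hasDerivAt_pow 2 t) (pow_ne_zero 2 ht)).congr_deriv ?_
  simp only [Pi.mul_apply]
  field_simp
  ring

theorem strictMonoOn_logCosh_mul_add_one_div_sq :
    StrictMonoOn (fun t => logCosh t * (logCosh t + 1) / t ^ 2) (Ioi 0) := by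
  refine strictMonoOn_of_deriv_pos (convex_Ioi 0) (fun t ht =>
    (hasDerivAt_logCosh_mul_add_div_sq 1 (ne_of_gt ht)).continuousAt.continuousWithinAt) ?_
  rw [interior_Ioi]
  intro t ht
  rw [(hasDerivAt_logCosh_mul_add_div_sq 1 (ne_of_gt ht)).deriv]
  exact div_pos (sub_pos.2 (two_mul_logCosh_mul_add_one_lt_mul_tanh ht)) (pow_pos ht 3)

theorem strictAntiOn_logCosh_mul_add_three_div_sq :
    StrictAntiOn (fun t => logCosh t * (logCosh t + 3) / t ^ 2) (Ioi 0) := by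
  refine strictAntiOn_of_deriv_neg (convex_Ioi 0) (fun t ht =>
    (hasDerivAt_logCosh_mul_add_div_sq 3 (ne_of_gt ht)).continuousAt.continuousWithinAt) ?_
  rw [interior_Ioi]
  intro t ht
  rw [(hasDerivAt_logCosh_mul_add_div_sq 3 (ne_of_gt ht)).deriv]
  exact div_neg_of_neg_of_pos (sub_neg.2 (mul_tanh_lt_two_mul_logCosh_mul_add_three ht))
    (pow_pos ht 3)

end LogCosh

/-- The slope `S` of the affine function `x ↦ l + S * x` through the points `(1, logCosh t)` and
`(r ^ 2, logCosh (r * t))`, that is, of a chord of `x ↦ logCosh (√x * t)`. At `r = 1` it is the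
slope of the tangent. -/
noncomputable def logCoshSlope (r t : ℝ) : ℝ :=
  if r = 1 then t * tanh t / 2 else (logCosh (r * t) - logCosh t) / (r ^ 2 - 1)

/-- The intercept `l` of the affine function `x ↦ l + S * x` whose slope `S` is `logCoshSlope`. -/
noncomputable def logCoshIntercept (r t : ℝ) : ℝ := logCosh t - logCoshSlope r t

section Chord

variable {r t : ℝ}

theorem logCoshSlope_mul (hr : 0 < r) (hr1 : r ≠ 1) (t : ℝ) :
    logCoshSlope r t * (r ^ 2 - 1) = logCosh (r * t) - logCosh t := by
  have h : r ^ 2 - 1 ≠ 0 := sub_ne_zero.2 ((pow_eq_one_iff_of_nonneg hr.le two_ne_zero).not.2 hr1)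
  rw [logCoshSlope, if_neg hr1, div_mul_cancel₀ _ h]

theorem logCosh_mul_eq (hr : 0 < r) (t : ℝ) :
    logCosh (r * t) = logCoshIntercept r t + r ^ 2 * logCoshSlope r t := by
  by_cases hr1 : r = 1
  · simp [hr1, logCoshIntercept]
  · rw [logCoshIntercept]
    linarith [logCoshSlope_mul hr hr1 t]

theorem sub_mul_sub_logCosh_mul_add_div_sq (c : ℝ) (hr : 0 < r) (ht : t ≠ 0) :
    (r * t - t) * (logCosh (r * t) * (logCosh (r * t) + c) / (r * t) ^ 2
        - logCosh t * (logCosh t + c) / t ^ 2)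
      = (r - 1) ^ 2 * (r + 1) / (r ^ 2 * t) *
        ((r * logCoshSlope r t) ^ 2 - logCoshIntercept r t * (logCoshIntercept r t + c)) := by
  rw [logCosh_mul_eq hr, show logCosh t = logCoshIntercept r t + logCoshSlope r t from
    (sub_add_cancel _ _).symm]
  field_simp
  ring

theorem logCoshIntercept_mul_add_one_lt_sq (hr : 0 < r) (ht : 0 < t) :
    logCoshIntercept r t * (logCoshIntercept r t + 1) < (r * logCoshSlope r t) ^ 2 := by
  by_cases hr1 : r = 1
  · simp only [logCoshIntercept, logCoshSlope, hr1, if_true]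
    linarith [two_mul_logCosh_mul_add_one_lt_mul_tanh ht]
  · have h := sub_mul_sub_pos_of_strictMonoOn strictMonoOn_logCosh_mul_add_one_div_sq
      (mem_Ioi.2 ht) (mem_Ioi.2 (mul_pos hr ht)) (by simpa [ht.ne'] using hr1)
    rw [sub_mul_sub_logCosh_mul_add_div_sq 1 hr ht.ne'] at h
    exact sub_pos.1 (pos_of_mul_pos_right h (by positivity))

theorem sq_lt_logCoshIntercept_mul_add_three (hr : 0 < r) (ht : 0 < t) :
    (r * logCoshSlope r t) ^ 2 < logCoshIntercept r t * (logCoshIntercept r t + 3) := by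
  by_cases hr1 : r = 1
  · simp only [logCoshIntercept, logCoshSlope, hr1, if_true]
    linarith [mul_tanh_lt_two_mul_logCosh_mul_add_three ht]
  · have h := sub_mul_sub_pos_of_strictMonoOn strictAntiOn_logCosh_mul_add_three_div_sq.neg
      (mem_Ioi.2 ht) (mem_Ioi.2 (mul_pos hr ht)) (by simpa [ht.ne'] using hr1)
    rw [← neg_sub', mul_neg, sub_mul_sub_logCosh_mul_add_div_sq 3 hr ht.ne', ← mul_neg] at h
    exact sub_neg.1 (neg_pos.1 (pos_of_mul_pos_right h (by positivity)))

theorem logCoshIntercept_pos (hr : 0 < r) (ht : 0 < t) : 0 < logCoshIntercept r t := by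
  linarith [logCoshIntercept_mul_add_one_lt_sq hr ht, sq_lt_logCoshIntercept_mul_add_three hr ht]

theorem logCoshSlope_pos (hr : 0 < r) (ht : 0 < t) : 0 < logCoshSlope r t := by
  have hP := logCosh_pos ht
  have hQ := logCosh_pos (mul_pos hr ht)
  have h : logCosh t * (logCosh t + 1)
      < logCoshSlope r t * (logCosh t + logCosh (r * t) + 1) := by
    have := logCoshIntercept_mul_add_one_lt_sq hr ht
    rw [logCoshIntercept] at this
    rw [logCosh_mul_eq hr, logCoshIntercept]
    linarith
  exact pos_of_mul_pos_left (lt_trans (by positivity) h) (by positivity)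

theorem logCoshSlope_add_mul_le (hr : 0 < r) (ht : 0 < t) :
    logCoshSlope r t + r * logCoshSlope r t ≤ t := by
  by_cases hr1 : r = 1
  · simp only [logCoshSlope, hr1, if_true]
    linarith [mul_lt_mul_of_pos_left (tanh_lt_one t) ht]
  · have hS : 0 < (1 + r) * logCoshSlope r t := mul_pos (by positivity) (logCoshSlope_pos hr ht)
    have h : |r - 1| * ((1 + r) * logCoshSlope r t) ≤ |r - 1| * t := by
      calc |r - 1| * ((1 + r) * logCoshSlope r t)
          = |(r - 1) * ((1 + r) * logCoshSlope r t)| := by rw [abs_mul, abs_of_pos hS]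
        _ = |logCosh (r * t) - logCosh t| := by
            rw [← logCoshSlope_mul hr hr1]
            ring_nf
        _ ≤ |r * t - t| := abs_logCosh_sub_le _ _
        _ = |r - 1| * t := by rw [← sub_one_mul, abs_mul, abs_of_pos ht]
    linarith [le_of_mul_le_mul_left h (abs_pos.2 (sub_ne_zero.2 hr1))]

end Chord

section Estimates

variable {l t z : ℝ}

theorem two_mul_lt_logCosh_two_mul (hz : 0 < z) (h : l * (l + 1) < z ^ 2) :
    2 * l < logCosh (2 * z) := by
  have hx := sq_lt_logCosh_mul_add_two (t := 2 * z) (by positivity)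
  have hL := logCosh_pos (t := 2 * z) (by positivity)
  by_contra! hle
  have hl : 0 < 2 * l := hL.trans_le hle
  have : logCosh (2 * z) * (logCosh (2 * z) + 2) ≤ 2 * l * (2 * l + 2) := by gcongr
  linarith

theorem exp_add_sq_le (hl : 0 ≤ l) (hl' : l ≤ 1 / 4) : exp (l + l ^ 2) ≤ 1 + 2 * l := by
  have hsq : l ^ 2 ≤ l / 4 := by nlinarith
  have h := le_of_abs_le (abs_exp_sub_one_sub_id_le (x := l + l ^ 2)
    (abs_le.2 ⟨by nlinarith, by linarith⟩))
  nlinarith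

theorem exp_neg_mul_cosh_sq_le_one_add (hl : 0 ≤ l) (hl' : l ≤ 1 / 4) (hz : z ^ 2 ≤ l * (l + 3)) :
    (exp (-l) * cosh z) ^ 2 ≤ 1 + 2 * l :=
  calc (exp (-l) * cosh z) ^ 2
      ≤ (exp (-l) * exp (z ^ 2 / 2)) ^ 2 := by
        gcongr
        exact cosh_le_exp_half_sq z
    _ = exp (z ^ 2 - 2 * l) := by
        rw [← exp_add, ← exp_nat_mul]
        congr 1
        push_cast
        ring
    _ ≤ exp (l + l ^ 2) := exp_le_exp.2 (by linarith)
    _ ≤ 1 + 2 * l := exp_add_sq_le hl hl'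

theorem add_inv_div_two_sq_lt {d : ℝ} (hd : 0 < d) :
    ((1 + d + ((1 + d ^ 2 / 2) * (1 + d))⁻¹) / 2) ^ 2 < 1 + d ^ 2 / 2 := by
  have h : (1 + d + ((1 + d ^ 2 / 2) * (1 + d))⁻¹) / 2
      = ((1 + d ^ 2 / 2) * (1 + d) ^ 2 + 1) / (2 * ((1 + d ^ 2 / 2) * (1 + d))) := by
    field_simp
  rw [h, div_pow, div_lt_iff₀ (by positivity), ← sub_pos]
  ring_nf
  positivity

theorem exp_neg_mul_cosh_sq_lt_one_add_tanh_sq (ht : 0 < t) (hl : tanh t ^ 2 / 4 ≤ l)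
    (hz : |z| ≤ t - logCosh t + l) : (exp (-l) * cosh z) ^ 2 < 1 + tanh t ^ 2 / 2 := by
  have hd := tanh_pos ht
  have hexp : exp (-(2 * l)) ≤ (1 + tanh t ^ 2 / 2)⁻¹ := by
    rw [exp_neg]
    gcongr
    linarith [add_one_le_exp (2 * l)]
  have hle : exp (-l) * cosh z ≤ (1 + tanh t + ((1 + tanh t ^ 2 / 2) * (1 + tanh t))⁻¹) / 2 :=
    calc exp (-l) * cosh z
        ≤ exp (-l) * cosh (t - logCosh t + l) := by
          gcongr
          exact cosh_le_cosh.2 (hz.trans (le_abs_self _))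
      _ = (exp (t - logCosh t) + exp (-(2 * l)) * (exp (t - logCosh t))⁻¹) / 2 := by
          rw [← exp_neg (t - logCosh t), ← exp_add, cosh_eq, ← mul_div_assoc, mul_add, ← exp_add,
            ← exp_add]
          ring_nf
      _ ≤ (1 + tanh t + ((1 + tanh t ^ 2 / 2) * (1 + tanh t))⁻¹) / 2 := by
          rw [exp_sub_logCosh, mul_inv]
          gcongr
  exact (pow_le_pow_left₀ (mul_pos (exp_pos _) (cosh_pos _)).le hle 2).trans_lt
    (add_inv_div_two_sq_lt hd)

end Estimates

section ChordEstimates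

variable {r t : ℝ}

theorem cosh_sq_lt_exp_logCoshSlope_mul_cosh (hr : 0 < r) (ht : 0 < t) :
    cosh t ^ 2 < exp (2 * logCoshSlope r t) * cosh (2 * (r * logCoshSlope r t)) := by
  have h := two_mul_lt_logCosh_two_mul (mul_pos hr (logCoshSlope_pos hr ht))
    (logCoshIntercept_mul_add_one_lt_sq hr ht)
  rw [← exp_logCosh, ← exp_logCosh (2 * _), ← exp_add, ← exp_nat_mul, exp_lt_exp]
  rw [logCoshIntercept] at h
  push_cast
  linarith

theorem exp_neg_logCoshIntercept_mul_cosh_sq_lt (hr : 0 < r) (ht : 0 < t) :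
    (exp (-logCoshIntercept r t) * cosh (r * logCoshSlope r t)) ^ 2 < 1 + tanh t ^ 2 / 2 := by
  rcases lt_or_ge (logCoshIntercept r t) (tanh t ^ 2 / 4) with hl | hl
  · have h := exp_neg_mul_cosh_sq_le_one_add (logCoshIntercept_pos hr ht).le
      (by linarith [tanh_sq_lt_one t]) (sq_lt_logCoshIntercept_mul_add_three hr ht).le
    linarith
  · refine exp_neg_mul_cosh_sq_lt_one_add_tanh_sq ht hl ?_
    rw [abs_of_pos (mul_pos hr (logCoshSlope_pos hr ht)), logCoshIntercept]
    linarith [logCoshSlope_add_mul_le hr ht]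

theorem exp_logCoshSlope_mul_cosh_sq_lt (hr : 0 < r) (ht : 0 < t) :
    (exp (logCoshSlope r t) * cosh (r * logCoshSlope r t)) ^ 2 < (3 * cosh t ^ 2 - 1) / 2 := by
  have hS : exp (logCoshSlope r t) = cosh t * exp (-logCoshIntercept r t) := by
    rw [← exp_logCosh, ← exp_add, logCoshIntercept]
    ring_nf
  calc (exp (logCoshSlope r t) * cosh (r * logCoshSlope r t)) ^ 2
      = cosh t ^ 2 * (exp (-logCoshIntercept r t) * cosh (r * logCoshSlope r t)) ^ 2 := by
        rw [hS]
        ring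
    _ < cosh t ^ 2 * (1 + tanh t ^ 2 / 2) :=
        mul_lt_mul_of_pos_left (exp_neg_logCoshIntercept_mul_cosh_sq_lt hr ht)
          (pow_pos (cosh_pos t) 2)
    _ = (3 * cosh t ^ 2 - 1) / 2 := by linarith [cosh_sq_mul_one_sub_tanh_sq t]

end ChordEstimates

section Mean

variable {r : ℝ}

theorem exp_add_add_exp_sub (x y : ℝ) : exp (x + y) + exp (x - y) = 2 * exp x * cosh y := by
  rw [sub_eq_add_neg, exp_add, exp_add, cosh_eq]
  ring

theorem exp_add_sub_exp_sub (x y : ℝ) : exp (x + y) - exp (x - y) = 2 * exp x * sinh y := by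
  rw [exp_add, sub_eq_add_neg x, exp_add, sinh_eq]
  ring

theorem exists_exp_sub_exp_add {a b : ℝ} (ha : 0 < a) (hab : a < b) :
    ∃ g t : ℝ, 0 < t ∧ a = exp (g - t) ∧ b = exp (g + t) := by
  refine ⟨(log b + log a) / 2, (log b - log a) / 2, ?_, ?_, ?_⟩
  · linarith [log_lt_log ha hab]
  · ring_nf
    rw [exp_log ha]
  · ring_nf
    rw [exp_log (ha.trans hab)]

theorem genInvHarmonicMean_exp (hr : r ≠ 1) (g t : ℝ) :
    genInvHarmonicMean r (exp (g - t)) (exp (g + t))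
      = exp (g + (logCosh (r * t) - logCosh t) / (r - 1)) := by
  have hr' : r - 1 ≠ 0 := sub_ne_zero.2 hr
  have hquot : (exp (g + t) ^ r + exp (g - t) ^ r) / (exp (g + t) + exp (g - t))
      = exp (g * (r - 1) + (logCosh (r * t) - logCosh t)) := by
    rw [← exp_mul, ← exp_mul, add_mul, sub_mul, exp_add_add_exp_sub, exp_add_add_exp_sub,
      exp_add, exp_sub (logCosh _), mul_comm t r, exp_logCosh, exp_logCosh, mul_sub_one,
      exp_sub (g * r)]
    field_simp
  rw [genInvHarmonicMean, if_neg hr, hquot, ← exp_mul]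
  congr 1
  field_simp

theorem genInvHarmonicMean_one_exp (g t : ℝ) :
    genInvHarmonicMean 1 (exp (g - t)) (exp (g + t)) = exp (g + t * tanh t) := by
  have hc : cosh t ≠ 0 := (cosh_pos t).ne'
  have hlog : (g + t) * exp (g + t) + (g - t) * exp (g - t)
      = (g + t * tanh t) * (2 * exp g * cosh t) := by
    rw [tanh_eq_sinh_div_cosh]
    field_simp
    linear_combination g * exp_add_add_exp_sub g t + t * exp_add_sub_exp_sub g t
  rw [genInvHarmonicMean, if_pos rfl, ← exp_mul, ← exp_mul, ← exp_add, ← exp_mul, hlog,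
    exp_add_add_exp_sub]
  congr 1
  field_simp

theorem genInvHarmonicMean_exp_eq (hr : 0 < r) (g t : ℝ) :
    genInvHarmonicMean r (exp (g - t)) (exp (g + t))
      = exp (g + logCoshSlope r t + r * logCoshSlope r t) := by
  by_cases hr1 : r = 1
  · rw [hr1, genInvHarmonicMean_one_exp, logCoshSlope, if_pos rfl]
    ring_nf
  · have hr' : r - 1 ≠ 0 := sub_ne_zero.2 hr1
    rw [genInvHarmonicMean_exp hr1, ← logCoshSlope_mul hr hr1]
    congr 1
    field_simp
    ring

theorem genInvHarmonicMean_neg_exp_eq (hr : 0 < r) (g t : ℝ) :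
    genInvHarmonicMean (-r) (exp (g - t)) (exp (g + t))
      = exp (g + logCoshSlope r t - r * logCoshSlope r t) := by
  have hr' : -r - 1 ≠ 0 := by linarith
  rw [genInvHarmonicMean_exp (by linarith), neg_mul, logCosh_neg, logCosh_mul_eq hr,
    logCoshIntercept]
  congr 1
  field_simp
  ring

theorem three_mul_exp_sq_eq (g t : ℝ) :
    (3 * exp (g - t) ^ 2 + 2 * exp (g - t) * exp (g + t) + 3 * exp (g + t) ^ 2) / 2
      = (2 * exp g) ^ 2 * ((3 * cosh t ^ 2 - 1) / 2) := by
  have hprod : exp (g - t) * exp (g + t) = exp g ^ 2 := by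
    rw [← exp_add, ← exp_nat_mul]
    ring_nf
  linear_combination (3 / 2 * (exp (g + t) + exp (g - t)) + 3 * exp g * cosh t) *
    exp_add_add_exp_sub g t - 2 * hprod

theorem exp_add_sq_add_exp_sub_sq (x y : ℝ) :
    exp (x + y) ^ 2 + exp (x - y) ^ 2 = 2 * exp (2 * x) * cosh (2 * y) := by
  rw [← exp_add_add_exp_sub, ← exp_nat_mul, ← exp_nat_mul]
  push_cast
  ring_nf

end Mean

theorem corollary6p1 (r a b : ℝ) (hr : 0 < r) (ha : 0 < a) (hab : a < b) :
    genInvHarmonicMean r a b + genInvHarmonicMean (-r) a b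
        < Real.sqrt ((3 * a ^ 2 + 2 * a * b + 3 * b ^ 2) / 2) ∧
      (a + b) ^ 2 / 2 < genInvHarmonicMean r a b ^ 2 + genInvHarmonicMean (-r) a b ^ 2 := by
  obtain ⟨g, t, ht, rfl, rfl⟩ := exists_exp_sub_exp_add ha hab
  rw [genInvHarmonicMean_exp_eq hr, genInvHarmonicMean_neg_exp_eq hr]
  set S := logCoshSlope r t
  constructor
  · rw [three_mul_exp_sq_eq, exp_add_add_exp_sub]
    refine lt_sqrt_of_sq_lt ?_
    calc (2 * exp (g + S) * cosh (r * S)) ^ 2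
        = (2 * exp g) ^ 2 * (exp S * cosh (r * S)) ^ 2 := by rw [exp_add]; ring
      _ < (2 * exp g) ^ 2 * ((3 * cosh t ^ 2 - 1) / 2) := by
        gcongr
        exact exp_logCoshSlope_mul_cosh_sq_lt hr ht
  · calc (exp (g - t) + exp (g + t)) ^ 2 / 2
        = 2 * exp g ^ 2 * cosh t ^ 2 := by rw [add_comm, exp_add_add_exp_sub]; ring
      _ < 2 * exp g ^ 2 * (exp (2 * S) * cosh (2 * (r * S))) := by
        gcongr
        exact cosh_sq_lt_exp_logCoshSlope_mul_cosh hr ht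
      _ = exp (g + S + r * S) ^ 2 + exp (g + S - r * S) ^ 2 := by
        rw [exp_add_sq_add_exp_sub_sq, mul_add, exp_add, ← exp_nat_mul]
        push_cast
        ring
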